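/- Let $n\ge 1$, let $\Sigma$ be a connected, complete, smooth Riemannian $n$-manifold without boundary, and let $F:\Sigma\to\mathbb{R}^{n+1}$ be a smooth isometric immersion with a smooth unit normal field $\mathbf{n}$. Put $A(X)=-D_X\mathbf{n}$ for tangent vectors $X$, and let $H=\operatorname{tr}(-A)$ be the mean curvature. Suppose that, for some $\lambda\in\mathbb{R}$, $\Sigma$ is a $\lambda$-self-expander, i.e. $$H(p)=-\frac{\langle F(p),\mathbf{n}(p)\rangle}{2}+\lambda\qquad\text{for all }p\in\Sigma,$$ that the immersion is proper (preimages under $F$ of compact subsets of $\mathbb{R}^{n+1}$ are compact), and that $$\lambda^2\ \ge\ 2n+(\lambda-2H(p))^2\qquad\text{for all }p\in\Sigma .$$ Then $\Sigma$ is a round sphere centred at the origin: there is $r>0$ such that $F(\Sigma)=\mathbb{S}^n_r(0)=\{x\in\mathbb{R}^{n+1}:|x|=r\}$, the map $F:\Sigma\to\mathbb{S}^n_r(0)$ is a covering map, and, if $n\ge 2$, $F$ is injective (so that $F$ is an embedding of $\Sigma$ onto $\mathbb{S}^n_r(0)$). -/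

import Mathlib

open Bundle
open scoped Manifold ContDiff RealInnerProductSpace

noncomputable section

namespace LambdaExpander

/-- The ambient Euclidean space `ℝⁿ⁺¹`. -/
abbrev Ambient (n : ℕ) : Type := EuclideanSpace ℝ (Fin (n + 1))

section Basic

variable {n : ℕ} {M : Type*} [TopologicalSpace M] [ChartedSpace (EuclideanSpace ℝ (Fin n)) M]

instance tangentFiniteDimensional (p : M) : FiniteDimensional ℝ (TangentSpace (𝓡 n) p) :=
  inferInstanceAs (FiniteDimensional ℝ (EuclideanSpace ℝ (Fin n)))

/-- The differential at `p` of a map `G : M → ℝⁿ⁺¹`, i.e. the directional derivative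
`X ↦ D_X G` for `X ∈ T_pM`, with values in the vector space `ℝⁿ⁺¹` itself. -/
def differential (G : M → Ambient n) (p : M) : TangentSpace (𝓡 n) p →ₗ[ℝ] Ambient n :=
  (mvfderiv (𝓡 n) G p).toLinearMap

end Basic

section Riemannian

variable {n : ℕ} {M : Type*} [TopologicalSpace M] [ChartedSpace (EuclideanSpace ℝ (Fin n)) M]
  [RiemannianBundle (fun p : M => TangentSpace (𝓡 n) p)]

/-- `F : M → ℝⁿ⁺¹` is a smooth isometric immersion: the Riemannian metric of `M` is the one
induced by `F`. -/
structure IsIsometricImmersion (F : M → Ambient n) : Prop where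
  contMDiff : ContMDiff (𝓡 n) (𝓡 (n + 1)) ∞ F
  inner_differential : ∀ (p : M) (X Y : TangentSpace (𝓡 n) p),
    ⟪differential F p X, differential F p Y⟫ = ⟪X, Y⟫

/-- `N` is a smooth unit normal field along the immersion `F`. -/
structure IsUnitNormal (F N : M → Ambient n) : Prop where
  contMDiff : ContMDiff (𝓡 n) (𝓡 (n + 1)) ∞ N
  norm_eq_one : ∀ p : M, ‖N p‖ = 1
  inner_eq_zero : ∀ (p : M) (X : TangentSpace (𝓡 n) p), ⟪differential F p X, N p⟫ = 0

/-- The second fundamental form (shape operator) `A_p : T_pM → T_pM`, `A X = - D_X N`, of the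
isometric immersion `F` with unit normal `N`. The vector `D_X N` of `ℝⁿ⁺¹` is tangent to the
hypersurface; it is pulled back to `T_pM` by the adjoint of `dF_p`, which inverts the isometry
`dF_p : T_pM → dF_p(T_pM)`. -/
def shapeOperator (F N : M → Ambient n) (p : M) :
    TangentSpace (𝓡 n) p →ₗ[ℝ] TangentSpace (𝓡 n) p :=
  -(LinearMap.adjoint (differential F p) ∘ₗ differential N p)

/-- The mean curvature `H = tr (-A)`. -/
def meanCurvature (F N : M → Ambient n) (p : M) : ℝ :=
  LinearMap.trace ℝ (TangentSpace (𝓡 n) p) (-shapeOperator F N p)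

/-- `F : M → ℝⁿ⁺¹` is an immersed `lam`-self-expander with unit normal `N`:
`H = -⟨x, N⟩ / 2 + lam`, where `x = F p` is the position vector. -/
structure IsSelfExpander (lam : ℝ) (F N : M → Ambient n) : Prop where
  isometricImmersion : IsIsometricImmersion F
  unitNormal : IsUnitNormal F N
  meanCurvature_eq : ∀ p : M, meanCurvature F N p = -⟪F p, N p⟫ / 2 + lam

end Riemannian

end LambdaExpander

end

/-! The self-expander equation says `⟪F, N⟫ = 2 (lam - H)`, so the pinching condition is exactly `n
≤ H ⟪F, N⟫`. The Laplacian of `|F|²` on the hypersurface is `2n - 2 H ⟪F, N⟫`, so `|F|²` is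
superharmonic. Properness makes it attain its minimum, and the strong minimum principle with
connectedness makes it constant: the image lies in a sphere centred at the origin.

The minimum principle (`eventually_norm_eq_of_forall_norm_le`) follows Hopf's barrier argument, with
ambient balls instead of balls in a chart. The barrier is the restriction of an ambient function, so
its Laplacian needs only the ambient Hessian and `H` (`laplacian_nonneg_of_isLocalMin`). For the
Gaussian term to have a Laplacian of definite sign, chords must stay away from the normal direction,
which holds locally on an immersed hypersurface (`exists_nhds_injOn_and_abs_inner_le`).

An immersion into a sphere of the same dimension is a local homeomorphism. As properness makes `M`
compact, it is a covering, onto because the sphere is connected. For `2 ≤ n` the sphere is a union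
of two simply connected open sets with connected intersection; sections over them glue, so a
connected covering is injective. -/

/-! ### Second order calculus and orthonormal expansions -/

open Topology Filter in
/-- Necessary second order condition at a local minimum of a function of one variable. -/
theorem IsLocalMin.second_deriv_nonneg {h h' : ℝ → ℝ} {a h'' : ℝ} (hm : IsLocalMin h a)
    (h1 : ∀ᶠ t in 𝓝 a, HasDerivAt h (h' t) t) (h2 : HasDerivAt h' h'' a) : 0 ≤ h'' := by
  by_contra! hneg
  have hd : deriv h =ᶠ[𝓝 a] h' := h1.mono fun t ht => ht.deriv
  have h0 : deriv h a = 0 := hm.deriv_eq_zero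
  have hdd : deriv (deriv h) a = h'' := by rw [hd.deriv_eq, h2.deriv]
  -- A strictly negative second derivative would make the minimum a maximum as well, hence `h`
  -- locally constant, hence the second derivative zero.
  have hmax : IsLocalMax h a :=
    isLocalMax_of_deriv_deriv_neg (by rw [hdd]; exact hneg) h0 h1.self_of_nhds.continuousAt
  have hconst : h =ᶠ[𝓝 a] fun _ => h a := by
    filter_upwards [hm, hmax] with t ht ht' using le_antisymm ht' ht
  have hz : deriv h =ᶠ[𝓝 a] fun _ => 0 := by
    simpa using hconst.deriv
  have : h'' = 0 := by rw [← hdd, hz.deriv_eq, deriv_const]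
  exact hneg.ne this

section VectorSpace

open Topology Filter

variable {V E : Type*} [NormedAddCommGroup V] [NormedSpace ℝ V]
  [NormedAddCommGroup E] [InnerProductSpace ℝ E]

/-- First and second order conditions at a local minimum of `G ∘ f`, in the direction `v`, in
terms of the gradient `g` of `G`. -/
theorem IsLocalMin.comp_second_order {f : V → E} {x v : V} (hf : ContDiffAt ℝ 2 f x)
    {G : E → ℝ} {g : E → E} {Q : E →L[ℝ] E} (hG : ∀ y, HasFDerivAt G (innerSL ℝ (g y)) y)
    (hg : HasFDerivAt g Q (f x)) (hm : IsLocalMin (G ∘ f) x) :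
    ⟪g (f x), fderiv ℝ f x v⟫ = 0 ∧
      0 ≤ ⟪Q (fderiv ℝ f x v), fderiv ℝ f x v⟫ + ⟪g (f x), fderiv ℝ (fderiv ℝ f) x v v⟫ := by
  -- Both conditions are the one-variable ones along the line `t ↦ x + t • v`.
  have hline : ∀ t : ℝ, HasDerivAt (fun t : ℝ => x + t • v) v t := fun t => by
    simpa using ((hasDerivAt_id t).smul_const v).const_add x
  have hline0 : Tendsto (fun t : ℝ => x + t • v) (𝓝 0) (𝓝 x) := by
    simpa using (hline 0).continuousAt.tendsto
  have hdiff : ∀ᶠ y in 𝓝 x, DifferentiableAt ℝ f y := by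
    filter_upwards [hf.eventually (by simp)] with y hy using hy.differentiableAt (by simp)
  have hc : ∀ᶠ t in 𝓝 (0 : ℝ),
      HasDerivAt (fun t : ℝ => f (x + t • v)) (fderiv ℝ f (x + t • v) v) t := by
    filter_upwards [hline0.eventually hdiff] with t ht
    exact ht.hasFDerivAt.comp_hasDerivAt t (hline t)
  have hd2 : DifferentiableAt ℝ (fderiv ℝ f) x :=
    (hf.fderiv_right (m := 1) (by norm_num)).differentiableAt (by simp)
  have hc2 : HasDerivAt (fun t : ℝ => fderiv ℝ f (x + t • v) v)
      (fderiv ℝ (fderiv ℝ f) x v v) 0 := by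
    have h := HasFDerivAt.comp_hasDerivAt_of_eq (0 : ℝ) hd2.hasFDerivAt (hline 0) (by simp)
    exact h.clm_apply (hasDerivAt_const _ v) |>.congr_deriv (by simp)
  have h1 : ∀ᶠ t in 𝓝 (0 : ℝ), HasDerivAt (fun t : ℝ => G (f (x + t • v)))
      ⟪g (f (x + t • v)), fderiv ℝ f (x + t • v) v⟫ t := by
    filter_upwards [hc] with t ht
    exact (hG _).comp_hasDerivAt t ht
  have h2 : HasDerivAt (fun t : ℝ => ⟪g (f (x + t • v)), fderiv ℝ f (x + t • v) v⟫)
      (⟪Q (fderiv ℝ f x v), fderiv ℝ f x v⟫ + ⟪g (f x), fderiv ℝ (fderiv ℝ f) x v v⟫) 0 := by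
    have hg' : HasDerivAt (fun t : ℝ => g (f (x + t • v))) (Q (fderiv ℝ f x v)) 0 := by
      have := HasFDerivAt.comp_hasDerivAt_of_eq (0 : ℝ) hg hc.self_of_nhds (by simp)
      simpa [Function.comp_def] using this
    refine (hg'.inner ℝ hc2).congr_deriv ?_
    simp [add_comm]
  have hmin : IsLocalMin (fun t : ℝ => G (f (x + t • v))) 0 := by
    have := hline0.eventually hm
    simpa [IsLocalMin, IsMinFilter] using this
  refine ⟨?_, hmin.second_deriv_nonneg h1 h2⟩
  have := hmin.hasDerivAt_eq_zero h1.self_of_nhds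
  simpa using this

/-- Differentiating the tangency relation in the direction `v` expresses the normal part of the
second derivative of an immersion through the derivative of its normal. -/
theorem inner_second_fderiv_of_inner_fderiv_eq_zero {f ν : V → E} {x v : V}
    (hf : ContDiffAt ℝ 2 f x) (hν : DifferentiableAt ℝ ν x)
    (h : ∀ᶠ y in 𝓝 x, ⟪fderiv ℝ f y v, ν y⟫ = 0) :
    ⟪fderiv ℝ (fderiv ℝ f) x v v, ν x⟫ = -⟪fderiv ℝ f x v, fderiv ℝ ν x v⟫ := by
  have hd2 : DifferentiableAt ℝ (fderiv ℝ f) x :=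
    (hf.fderiv_right (m := 1) (by norm_num)).differentiableAt (by simp)
  have h1 : HasFDerivAt (fun y => fderiv ℝ f y v) ((fderiv ℝ (fderiv ℝ f) x).flip v) x := by
    refine (hd2.hasFDerivAt.clm_apply (hasFDerivAt_const v x)).congr_fderiv ?_
    ext w; simp
  have h2 := h1.inner ℝ hν.hasFDerivAt
  have h3 : HasFDerivAt (fun y => ⟪fderiv ℝ f y v, ν y⟫) (0 : V →L[ℝ] ℝ) x :=
    (hasFDerivAt_const (0 : ℝ) x).congr_of_eventuallyEq h
  have := congrArg (fun L : V →L[ℝ] ℝ => L v) (h2.unique h3)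
  simp at this
  linarith

/-- Parseval's identity for an orthonormal family of `n` vectors completed by a unit vector to a
basis of a space of dimension `n + 1`. -/
theorem inner_eq_sum_add_of_orthonormal {n : ℕ} [FiniteDimensional ℝ E]
    (hE : Module.finrank ℝ E = n + 1)
    {b : Fin n → E} (hb : Orthonormal ℝ b) {ν : E} (hν : ‖ν‖ = 1) (hbν : ∀ i, ⟪b i, ν⟫ = 0)
    (x y : E) : ⟪x, y⟫ = ∑ i, ⟪x, b i⟫ * ⟪b i, y⟫ + ⟪x, ν⟫ * ⟪ν, y⟫ := by
  have ho : Orthonormal ℝ (Fin.cons ν b : Fin (n + 1) → E) := by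
    rw [orthonormal_iff_ite] at hb ⊢
    intro i j
    refine Fin.cases ?_ (fun i => ?_) i <;> refine Fin.cases ?_ (fun j => ?_) j
    · simp [hν]
    · simpa [(Fin.succ_ne_zero j).symm, real_inner_comm] using hbν j
    · simp [hbν]
    · simp [hb i j]
  let B := basisOfOrthonormalOfCardEqFinrank ho (by simp [hE])
  have hB : (B : Fin (n + 1) → E) = Fin.cons ν b := coe_basisOfOrthonormalOfCardEqFinrank ho _
  let O := B.toOrthonormalBasis (by rw [hB]; exact ho)
  have hO : ∀ i, O i = (Fin.cons ν b : Fin (n + 1) → E) i := fun i => by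
    simp [O, hB]
  rw [← O.sum_inner_mul_inner, Fin.sum_univ_succ]
  simp [hO, add_comm]

end VectorSpace

/-! ### Maps read in the preferred chart -/

namespace LambdaExpander

section Chart

variable {n : ℕ} {M : Type*} [TopologicalSpace M] [ChartedSpace (EuclideanSpace ℝ (Fin n)) M]

/-- The expression of a map `G : M → ℝⁿ⁺¹` in the preferred chart at `p`. -/
noncomputable def inChart (G : M → Ambient n) (p : M) : EuclideanSpace ℝ (Fin n) → Ambient n :=
  G ∘ (extChartAt (𝓡 n) p).symm

theorem inChart_apply_extChartAt (G : M → Ambient n) (p : M) :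
    inChart G p (extChartAt (𝓡 n) p p) = G p := by
  simp [inChart]

theorem finrank_tangentSpace (p : M) : Module.finrank ℝ (TangentSpace (𝓡 n) p) = n := by
  change Module.finrank ℝ (EuclideanSpace ℝ (Fin n)) = n
  simp

theorem fderiv_inChart {G : M → Ambient n} (hG : ContMDiff (𝓡 n) (𝓡 (n + 1)) ∞ G) (p : M)
    (v : EuclideanSpace ℝ (Fin n)) :
    fderiv ℝ (inChart G p) (extChartAt (𝓡 n) p p) v =
      differential G p (v : EuclideanSpace ℝ (Fin n)) := by
  have h := (hG.mdifferentiableAt (x := p) (by simp)).mvfderiv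
  unfold differential
  rw [h]
  simp only [writtenInExtChartAt, extChartAt_model_space_eq_id]
  simp [fderivWithin_univ, inChart]
  rfl

variable [IsManifold (𝓡 n) ∞ M]

theorem contDiffAt_inChart {G : M → Ambient n} (hG : ContMDiff (𝓡 n) (𝓡 (n + 1)) ∞ G) (p : M)
    {x : EuclideanSpace ℝ (Fin n)} (hx : x ∈ (extChartAt (𝓡 n) p).target) :
    ContDiffAt ℝ ∞ (inChart G p) x := by
  have h : ContMDiffOn (𝓡 n) (𝓡 (n + 1)) ∞ (inChart G p) (extChartAt (𝓡 n) p).target :=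
    hG.comp_contMDiffOn (contMDiffOn_extChartAt_symm p)
  exact (contMDiffOn_iff_contDiffOn.1 h).contDiffAt ((isOpen_extChartAt_target p).mem_nhds hx)

/-- Chain rule at points other than the centre of the chart; `X` is the image of `v` under the
differential of the inverse chart, so it does not depend on `G`. -/
theorem exists_fderiv_inChart_eq_differential (p : M) {x : EuclideanSpace ℝ (Fin n)} (hx : x ∈ (extChartAt (𝓡 n) p).target)
    (v : EuclideanSpace ℝ (Fin n)) :
    ∃ X : TangentSpace (𝓡 n) ((extChartAt (𝓡 n) p).symm x),
      ∀ {G : M → Ambient n}, ContMDiff (𝓡 n) (𝓡 (n + 1)) ∞ G →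
        fderiv ℝ (inChart G p) x v = differential G ((extChartAt (𝓡 n) p).symm x) X := by
  have hs : MDifferentiableAt (𝓡 n) (𝓡 n) (extChartAt (𝓡 n) p).symm x :=
    ((contMDiffOn_extChartAt_symm (n := ∞) p).contMDiffAt
      ((isOpen_extChartAt_target p).mem_nhds hx)).mdifferentiableAt (by simp)
  refine ⟨mfderiv (𝓡 n) (𝓡 n) (extChartAt (𝓡 n) p).symm x v, fun {G} hG => ?_⟩
  have h := mfderiv_comp x (hG.mdifferentiableAt (by simp)) hs
  rw [mfderiv_eq_fderiv] at h
  change fderiv ℝ (G ∘ (extChartAt (𝓡 n) p).symm) x v = _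
  rw [h]
  rfl

end Chart

end LambdaExpander

/-! ### The Laplacian of a restricted ambient function at a minimum -/

namespace LambdaExpander

section Immersion

open Topology Filter

variable {n : ℕ} {M : Type*} [TopologicalSpace M] [ChartedSpace (EuclideanSpace ℝ (Fin n)) M]
  [RiemannianBundle (fun p : M => TangentSpace (𝓡 n) p)] {F N : M → Ambient n}

theorem IsIsometricImmersion.norm_differential (hF : IsIsometricImmersion F) (p : M)
    (X : TangentSpace (𝓡 n) p) : ‖differential F p X‖ = ‖X‖ := by
  rw [← sq_eq_sq₀ (norm_nonneg _) (norm_nonneg _), ← real_inner_self_eq_norm_sq,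
    ← real_inner_self_eq_norm_sq, hF.inner_differential]

theorem IsIsometricImmersion.differential_injective (hF : IsIsometricImmersion F) (p : M) :
    Function.Injective (differential F p) := by
  rw [injective_iff_map_eq_zero]
  intro X hX
  rw [← norm_eq_zero, ← hF.norm_differential, hX, norm_zero]

theorem meanCurvature_eq_sum (F N : M → Ambient n) (p : M)
    (e : OrthonormalBasis (Fin n) ℝ (TangentSpace (𝓡 n) p)) :
    meanCurvature F N p = ∑ i, ⟪differential F p (e i), differential N p (e i)⟫ := by
  rw [meanCurvature, LinearMap.trace_eq_sum_inner _ e]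
  simp [shapeOperator, LinearMap.adjoint_inner_right]

variable [IsManifold (𝓡 n) ∞ M]

/-- At a local minimum of the restriction to the hypersurface of an ambient function `G` with
gradient `g`, the Laplacian `∑ i, D²G(bᵢ, bᵢ) - H ⟨g, N⟩` of the restriction is nonnegative. -/
theorem laplacian_nonneg_of_isLocalMin (hF : IsIsometricImmersion F) (hN : IsUnitNormal F N)
    {p : M} {G : Ambient n → ℝ} {g : Ambient n → Ambient n} {Q : Ambient n →L[ℝ] Ambient n}
    (hG : ∀ y, HasFDerivAt G (innerSL ℝ (g y)) y) (hg : HasFDerivAt g Q (F p))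
    (hmin : IsLocalMin (G ∘ F) p) :
    ∃ b : Fin n → Ambient n, Orthonormal ℝ b ∧ (∀ i, ⟪b i, N p⟫ = 0) ∧
      0 ≤ ∑ i, ⟪Q (b i), b i⟫ - meanCurvature F N p * ⟪g (F p), N p⟫ := by
  let e : OrthonormalBasis (Fin n) ℝ (TangentSpace (𝓡 n) p) :=
    (stdOrthonormalBasis ℝ (TangentSpace (𝓡 n) p)).reindex (finCongr (finrank_tangentSpace p))
  have hb : Orthonormal ℝ fun i => differential F p (e i) := by
    have := e.orthonormal
    rw [orthonormal_iff_ite] at this ⊢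
    intro i j
    rw [hF.inner_differential, this i j]
  have hbN : ∀ i, ⟪differential F p (e i), N p⟫ = 0 := fun i => hN.inner_eq_zero p _
  refine ⟨_, hb, hbN, ?_⟩
  set x := extChartAt (𝓡 n) p p with hx
  have hxt : x ∈ (extChartAt (𝓡 n) p).target := mem_extChartAt_target p
  have hFx : ContDiffAt ℝ 2 (inChart F p) x :=
    (contDiffAt_inChart hF.contMDiff p hxt).of_le (WithTop.coe_le_coe.2 (le_top : (2 : ℕ∞) ≤ ⊤))
  have hNx : DifferentiableAt ℝ (inChart N p) x :=
    (contDiffAt_inChart hN.contMDiff p hxt).differentiableAt (by simp)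
  have hF0 : inChart F p x = F p := inChart_apply_extChartAt F p
  have hN0 : inChart N p x = N p := inChart_apply_extChartAt N p
  have hmin' : IsLocalMin (G ∘ inChart F p) x := by
    have ht : Tendsto (extChartAt (𝓡 n) p).symm (𝓝 x) (𝓝 p) := by
      simpa [hx] using (continuousAt_extChartAt_symm (I := 𝓡 n) p).tendsto
    have := ht.eventually hmin
    simpa [IsLocalMin, IsMinFilter, inChart, hx] using this
  have hperp : ∀ v, ∀ᶠ y in 𝓝 x, ⟪fderiv ℝ (inChart F p) y v, inChart N p y⟫ = 0 := fun v => by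
    filter_upwards [(isOpen_extChartAt_target p).mem_nhds hxt] with y hy
    obtain ⟨X, hX⟩ := exists_fderiv_inChart_eq_differential p hy v
    rw [hX hF.contMDiff]
    exact hN.inner_eq_zero _ X
  -- The same vectors, retyped in the model space, to which each tangent space is definitionally
  -- equal.
  obtain ⟨w, hw⟩ : ∃ w : Fin n → EuclideanSpace ℝ (Fin n), ∀ i,
      (w i : TangentSpace (𝓡 n) p) = e i := ⟨fun i => id (e i), fun _ => rfl⟩
  have hdF : ∀ i, fderiv ℝ (inChart F p) x (w i) = differential F p (e i) := fun i => by
    rw [← hw i]; exact fderiv_inChart hF.contMDiff p (w i)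
  have hdN : ∀ i, fderiv ℝ (inChart N p) x (w i) = differential N p (e i) := fun i => by
    rw [← hw i]; exact fderiv_inChart hN.contMDiff p (w i)
  have key : ∀ i, ⟪g (F p), differential F p (e i)⟫ = 0 ∧
      0 ≤ ⟪Q (differential F p (e i)), differential F p (e i)⟫ -
        ⟪differential F p (e i), differential N p (e i)⟫ * ⟪g (F p), N p⟫ := by
    have h1 : ∀ i, ⟪g (F p), differential F p (e i)⟫ = 0 := fun i => by
      have := (hmin'.comp_second_order hFx (v := w i) hG (by rw [hF0]; exact hg)).1
      rwa [hF0, hdF] at this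
    refine fun i => ⟨h1 i, ?_⟩
    have h2 := (hmin'.comp_second_order hFx (v := w i) hG (by rw [hF0]; exact hg)).2
    have h3 := inner_second_fderiv_of_inner_fderiv_eq_zero hFx hNx (hperp (w i))
    -- By the first order condition the gradient at `F p` is normal, so only the normal part of the
    -- second derivative of the chart expression contributes. No connection terms of the chart
    -- appear.
    rw [hdF, hF0, inner_eq_sum_add_of_orthonormal (by simp) hb
      (hN.norm_eq_one p) hbN (g (F p)), real_inner_comm _ (N p), ← hN0, h3,
      hdF, hdN, hN0] at h2
    simp only [h1, zero_mul, Finset.sum_const_zero, zero_add] at h2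
    linarith
  rw [meanCurvature_eq_sum F N p e, Finset.sum_mul, ← Finset.sum_sub_distrib]
  exact Finset.sum_nonneg fun i _ => (key i).2

end Immersion

end LambdaExpander

/-! ### Chords of an immersion and the barrier -/

namespace LambdaExpander

section Immersion

open Topology Filter

variable {n : ℕ} {M : Type*} [TopologicalSpace M] [ChartedSpace (EuclideanSpace ℝ (Fin n)) M]
  [RiemannianBundle (fun p : M => TangentSpace (𝓡 n) p)] {F N : M → Ambient n}
  [IsManifold (𝓡 n) ∞ M]

/-- Near every point an immersion is injective and its chords make a large angle with the
normal. -/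
theorem exists_nhds_injOn_and_abs_inner_le (hF : IsIsometricImmersion F) (hN : IsUnitNormal F N)
    (p : M) : ∃ V ∈ 𝓝 p, Set.InjOn F V ∧
      ∀ x ∈ V, ∀ y ∈ V, |⟪F x - F y, N x⟫| ≤ 1 / 2 * ‖F x - F y‖ := by
  set φ := extChartAt (𝓡 n) p with hφ
  set f := inChart F p with hf
  have hxt : φ p ∈ φ.target := mem_extChartAt_target p
  have hs : HasStrictFDerivAt f (fderiv ℝ f (φ p)) (φ p) :=
    (contDiffAt_inChart hF.contMDiff p hxt).hasStrictFDerivAt (by simp)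
  set L := fderiv ℝ f (φ p) with hL
  have hLd : ∀ v, L v = differential F p (v : EuclideanSpace ℝ (Fin n)) :=
    fderiv_inChart hF.contMDiff p
  have hinj : Function.Injective L := fun v w h => hF.differential_injective p (by
    rw [← hLd, ← hLd, h])
  obtain ⟨K, hK0, hK⟩ := L.toLinearMap.exists_antilipschitzWith (LinearMap.ker_eq_bot.2 hinj)
  have hK' : ∀ v, ‖v‖ ≤ K * ‖L v‖ := fun v => by
    simpa using hK.le_mul_dist v 0
  have hKpos : (0 : ℝ) < K := hK0
  -- With linearisation error `1 / (5K)` and `‖L v‖ ≥ ‖v‖ / K`, chords have length at least `4 /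
  -- (5K)` times the chart distance. The error is then at most `1/4` of the chord; the variation of
  -- `N` costs another `1/4`.
  have hδ : (0 : ℝ) < 1 / (5 * K) := by positivity
  have hev := hs.isLittleO.def hδ
  rw [nhds_prod_eq] at hev
  obtain ⟨U, hU, hUs⟩ := Filter.eventually_prod_self_iff'.1 hev
  have hV1 : φ ⁻¹' U ∈ 𝓝 p := (continuousAt_extChartAt p).preimage_mem_nhds hU
  have hV2 : φ.source ∈ 𝓝 p := extChartAt_source_mem_nhds p
  have hV3 : {x | ‖N x - N p‖ < 1 / 4} ∈ 𝓝 p := by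
    have : ContinuousAt (fun x => ‖N x - N p‖) p :=
      (hN.contMDiff.continuous.continuousAt.sub continuousAt_const).norm
    exact this.eventually_lt continuousAt_const (by simp)
  have hval : ∀ x ∈ φ.source, f (φ x) = F x := fun x hx => by
    rw [hf, inChart, Function.comp_apply, ← hφ, φ.left_inv hx]
  have hlow : ∀ x ∈ φ ⁻¹' U ∩ φ.source, ∀ y ∈ φ ⁻¹' U ∩ φ.source,
      ‖F x - F y - L (φ x - φ y)‖ ≤ 1 / (5 * K) * ‖φ x - φ y‖ ∧
      4 / (5 * K) * ‖φ x - φ y‖ ≤ ‖F x - F y‖ := by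
    intro x hx y hy
    have h1 := hUs (φ x) hx.1 (φ y) hy.1
    simp only [hval x hx.2, hval y hy.2] at h1
    refine ⟨h1, ?_⟩
    have h2 := hK' (φ x - φ y)
    have h3 : ‖L (φ x - φ y)‖ ≤ ‖F x - F y‖ + ‖F x - F y - L (φ x - φ y)‖ := by
      have := norm_sub_le (F x - F y) (F x - F y - L (φ x - φ y))
      simpa using this
    have h4 : 1 / K * ‖φ x - φ y‖ ≤ ‖L (φ x - φ y)‖ := by
      rw [one_div, inv_mul_le_iff₀ hKpos]; exact h2
    have h5 : 4 / (5 * (K : ℝ)) * ‖φ x - φ y‖ =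
        1 / K * ‖φ x - φ y‖ - 1 / (5 * K) * ‖φ x - φ y‖ := by
      field_simp; ring
    linarith
  refine ⟨_, inter_mem (inter_mem hV1 hV2) hV3, ?_, ?_⟩
  · intro x hx y hy hxy
    have h := (hlow x hx.1 y hy.1).2
    rw [hxy, sub_self, norm_zero] at h
    have h0 : ‖φ x - φ y‖ = 0 :=
      le_antisymm (nonpos_of_mul_nonpos_right h (by positivity)) (norm_nonneg _)
    exact φ.injOn hx.1.2 hy.1.2 (sub_eq_zero.1 (norm_eq_zero.1 h0))
  · intro x hx y hy
    obtain ⟨h1, h2⟩ := hlow x hx.1 y hy.1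
    have hLN : ⟪L (φ x - φ y), N p⟫ = 0 := by
      rw [hLd]; exact hN.inner_eq_zero p _
    have e : ⟪F x - F y, N x⟫ =
        ⟪F x - F y - L (φ x - φ y), N p⟫ + ⟪F x - F y, N x - N p⟫ := by
      rw [inner_sub_left (F x - F y) (L _), hLN, inner_sub_right]; ring
    have h3 : |⟪F x - F y - L (φ x - φ y), N p⟫| ≤ 1 / 4 * ‖F x - F y‖ := by
      refine (abs_real_inner_le_norm _ _).trans ?_
      rw [hN.norm_eq_one, mul_one]
      refine h1.trans ?_
      calc 1 / (5 * (K : ℝ)) * ‖φ x - φ y‖ = 1 / 4 * (4 / (5 * K) * ‖φ x - φ y‖) := by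
            field_simp
        _ ≤ _ := by gcongr
    have h4 : |⟪F x - F y, N x - N p⟫| ≤ 1 / 4 * ‖F x - F y‖ := by
      refine (abs_real_inner_le_norm _ _).trans ?_
      rw [mul_comm]
      have : ‖N x - N p‖ ≤ 1 / 4 := le_of_lt hx.2
      gcongr
    rw [e]
    exact (abs_add_le _ _).trans (by linarith)

/-- The function `|y|² - ε exp (-α |y - q|²)` restricted to the hypersurface has no local minimum
where `n ≤ H ⟨F, N⟩`, if `α` is large with respect to the distance to `q` and `F - q` is not close
to being normal. -/
theorem not_isLocalMin_barrier (hF : IsIsometricImmersion F) (hN : IsUnitNormal F N)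
    {p : M} {q : Ambient n} {ε α ρ Λ : ℝ} (hε : 0 < ε) (hρ : 0 < ρ) (hα : 0 < α)
    (hαρ : n + Λ * ρ < α * (3 / 8 * ρ ^ 2))
    (hH : n ≤ meanCurvature F N p * ⟪F p, N p⟫) (hΛ : |meanCurvature F N p| ≤ Λ)
    (hang : |⟪F p - q, N p⟫| ≤ 1 / 2 * ‖F p - q‖) (hle : ‖F p - q‖ ≤ ρ)
    (hge : ρ / 2 ≤ ‖F p - q‖) :
    ¬ IsLocalMin ((fun y => ‖y‖ ^ 2 - ε * Real.exp (-α * ‖y - q‖ ^ 2)) ∘ F) p := by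
  intro hmin
  let E : Ambient n → ℝ := fun y => Real.exp (-α * ‖y - q‖ ^ 2)
  have hE : ∀ y, HasFDerivAt E (innerSL ℝ ((-2 * α * E y) • (y - q))) y := fun y => by
    have h := ((((hasFDerivAt_id y).sub_const q).norm_sq).const_mul (-α)).exp
    refine h.congr_fderiv ?_
    ext v
    simp [E]
    ring
  have hG : ∀ y, HasFDerivAt (fun y => ‖y‖ ^ 2 - ε * Real.exp (-α * ‖y - q‖ ^ 2))
      (innerSL ℝ ((2 : ℝ) • y + (2 * ε * α * E y) • (y - q))) y := fun y => by
    have h := ((hasFDerivAt_id y).norm_sq).sub ((hE y).const_mul ε)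
    refine h.congr_fderiv ?_
    ext v
    simp
    ring
  obtain ⟨b, hb, hbN, h0⟩ := laplacian_nonneg_of_isLocalMin hF hN hG
    (((hasFDerivAt_id (F p)).const_smul (2 : ℝ)).add
      (((hE (F p)).const_mul (2 * ε * α)).smul ((hasFDerivAt_id (F p)).sub_const q))) hmin
  set w := F p - q with hw
  set H := meanCurvature F N p
  have hP : ‖w‖ ^ 2 = ∑ i, ⟪w, b i⟫ ^ 2 + ⟪w, N p⟫ ^ 2 := by
    rw [← real_inner_self_eq_norm_sq,
      inner_eq_sum_add_of_orthonormal (by simp) hb (hN.norm_eq_one p) hbN w w]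
    simp only [real_inner_comm w, sq]
  have hsum : ∑ i, (2 + 2 * ε * α * E (F p) * (1 - 2 * α * ⟪w, b i⟫ ^ 2)) =
      2 * n + 2 * ε * α * E (F p) * (n - 2 * α * ∑ i, ⟪w, b i⟫ ^ 2) := by
    simp [Finset.sum_add_distrib, ← Finset.mul_sum, Finset.sum_sub_distrib]
    ring
  have h1 : 0 ≤ 2 * n + 2 * ε * α * E (F p) * (n - 2 * α * ∑ i, ⟪w, b i⟫ ^ 2)
      - H * (2 * ⟪F p, N p⟫ + 2 * ε * α * E (F p) * ⟪w, N p⟫) := by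
    rw [← hsum]
    convert h0 using 2
    · refine Finset.sum_congr rfl fun i _ => ?_
      simp [inner_add_left, inner_smul_left, hb.1 i]
      ring
    · simp [inner_add_left, inner_smul_left]
  have hEpos : 0 < 2 * ε * α * E (F p) := by
    have : 0 < E (F p) := Real.exp_pos _
    positivity
  -- The angle condition leaves at least `3/4` of `‖w‖² ≥ ρ² / 4` to the tangential part. This is
  -- the term that carries the extra factor `α`.
  have hT : 3 / 16 * ρ ^ 2 ≤ ∑ i, ⟪w, b i⟫ ^ 2 := by
    have h2 : ⟪w, N p⟫ ^ 2 ≤ (1 / 2 * ‖w‖) ^ 2 := by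
      rw [← sq_abs]; gcongr
    have h3 : (ρ / 2) ^ 2 ≤ ‖w‖ ^ 2 := by gcongr
    nlinarith
  have hHw : |H * ⟪w, N p⟫| ≤ Λ * ρ := by
    rw [abs_mul]
    have : |⟪w, N p⟫| ≤ ρ := by linarith
    have : 0 ≤ Λ := (abs_nonneg _).trans hΛ
    gcongr
  have h4 : n - 2 * α * ∑ i, ⟪w, b i⟫ ^ 2 - H * ⟪w, N p⟫ < 0 := by
    have h5 := (abs_le.1 hHw).1
    have h6 : α * (3 / 16 * ρ ^ 2) ≤ α * ∑ i, ⟪w, b i⟫ ^ 2 := by gcongr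
    linarith
  have h7 := mul_neg_of_pos_of_neg hEpos h4
  linarith

end Immersion

end LambdaExpander

/-! ### The strong minimum principle -/

namespace LambdaExpander

section Immersion

open Topology Filter

variable {n : ℕ} {M : Type*} [TopologicalSpace M] [ChartedSpace (EuclideanSpace ℝ (Fin n)) M]
  [RiemannianBundle (fun p : M => TangentSpace (𝓡 n) p)] {F N : M → Ambient n}
  [IsManifold (𝓡 n) ∞ M]

/-- Strong minimum principle for `|F|` on an immersed hypersurface on which `|F|²` is
superharmonic. -/
theorem eventually_norm_eq_of_forall_norm_le [T2Space M]
    (hF : IsIsometricImmersion F) (hN : IsUnitNormal F N)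
    (hH : ∀ x, n ≤ meanCurvature F N x * ⟪F x, N x⟫) {Λ : ℝ} (hΛ : ∀ x, |meanCurvature F N x| ≤ Λ)
    {p : M} (hp : ∀ x, ‖F p‖ ≤ ‖F x‖) : ∀ᶠ x in 𝓝 p, ‖F x‖ = ‖F p‖ := by
  have hlc : LocallyCompactSpace M := Manifold.locallyCompact_of_finiteDimensional (𝓡 n)
  have hFc : Continuous F := hF.contMDiff.continuous
  obtain ⟨V, hV, hinj, hang⟩ := exists_nhds_injOn_and_abs_inner_le hF hN p
  obtain ⟨K, hKp, hKV, hK⟩ := local_compact_nhds hV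
  have hpK : p ∈ K := mem_of_mem_nhds hKp
  have hinjK : Set.InjOn F K := hinj.mono hKV
  -- points of `K` whose image is close to `F p` are interior points
  obtain ⟨δ, hδ, hδK⟩ : ∃ δ > 0, ∀ x ∈ K, ‖F x - F p‖ < δ → x ∈ interior K := by
    have hfr : IsCompact (K \ interior K) := hK.diff isOpen_interior
    have hnot : F p ∉ F '' (K \ interior K) := by
      rintro ⟨x, hx, hxp⟩
      have := hinjK hx.1 hpK hxp
      exact hx.2 (this ▸ mem_interior_iff_mem_nhds.2 hKp)
    obtain ⟨δ, hδ, hb⟩ := Metric.isOpen_iff.1 (hfr.image hFc).isClosed.isOpen_compl (F p) hnot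
    refine ⟨δ, hδ, fun x hx hxd => ?_⟩
    by_contra hxi
    exact hb (by rwa [Metric.mem_ball, dist_eq_norm]) ⟨x, ⟨hx, hxi⟩, rfl⟩
  by_contra hcon
  have hfreq : ∃ᶠ x in 𝓝 p, ‖F x‖ ≠ ‖F p‖ := Filter.not_eventually.1 hcon
  have hnear : ∀ᶠ x in 𝓝 p, x ∈ K ∧ ‖F x - F p‖ < δ / 3 := by
    refine (eventually_mem_set.2 hKp).and ?_
    have : ContinuousAt (fun x => ‖F x - F p‖) p := by fun_prop
    exact this.eventually_lt continuousAt_const (by simp; positivity)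
  obtain ⟨q, hqne, hqK, hqp⟩ := (hfreq.and_eventually hnear).exists
  set S : Set M := {x | ‖F x‖ = ‖F p‖} with hS
  have hSc : IsClosed S := isClosed_eq hFc.norm continuous_const
  -- Hopf's touching ball: `z` is a point of the minimum set in `K` whose image is nearest to `F q`,
  -- so this set avoids the open ball of radius `ρ` about `F q`.
  obtain ⟨z, ⟨hzK, hzS⟩, hz⟩ := (hK.inter_right hSc).exists_isMinOn ⟨p, hpK, rfl⟩
    (f := fun x => ‖F x - F q‖) (by fun_prop)
  have hz : ∀ x ∈ K, x ∈ S → ‖F z - F q‖ ≤ ‖F x - F q‖ := fun x hx hxS => hz ⟨hx, hxS⟩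
  set ρ := ‖F z - F q‖ with hρdef
  have hρ : 0 < ρ := by
    rw [hρdef, norm_pos_iff, sub_ne_zero]
    intro h
    have : z = q := hinjK hzK hqK h
    exact hqne (this ▸ hzS)
  have hρδ : ρ < δ / 3 := by
    have := hz p hpK rfl
    rw [norm_sub_rev] at this
    linarith
  have hint : ∀ x ∈ K, ‖F x - F q‖ ≤ ρ → x ∈ interior K := fun x hx hxq => by
    refine hδK x hx ?_
    have := norm_sub_le_norm_sub_add_norm_sub (F x) (F q) (F p)
    linarith
  -- `|F|²` exceeds its minimum by a definite amount on the inner ball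
  obtain ⟨ε, hε, hεin⟩ : ∃ ε > 0, ∀ x ∈ K, ‖F x - F q‖ ≤ ρ / 2 → ε ≤ ‖F x‖ ^ 2 - ‖F p‖ ^ 2 := by
    have hcl : IsClosed {x | ‖F x - F q‖ ≤ ρ / 2} :=
      isClosed_le (by fun_prop) continuous_const
    obtain ⟨y, ⟨hyK, hyq⟩, hy⟩ := (hK.inter_right hcl).exists_isMinOn
      ⟨q, hqK, by simp; positivity⟩ (f := fun x => ‖F x‖ ^ 2 - ‖F p‖ ^ 2) (by fun_prop)
    refine ⟨_, ?_, fun x hx hxq => hy ⟨hx, hxq⟩⟩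
    have hyS : ‖F y‖ ≠ ‖F p‖ := fun h => by
      have := hz y hyK h
      have h2 : ‖F y - F q‖ ≤ ρ / 2 := hyq
      linarith
    have hlt : ‖F p‖ < ‖F y‖ := lt_of_le_of_ne (hp y) hyS.symm
    exact sub_pos.2 (by gcongr)
  obtain ⟨α, hα, hαρ⟩ : ∃ α > 0, n + Λ * ρ < α * (3 / 8 * ρ ^ 2) := by
    have h : 0 < 3 / 8 * ρ ^ 2 := by positivity
    refine ⟨max 1 ((n + Λ * ρ + 1) / (3 / 8 * ρ ^ 2)), by positivity, ?_⟩
    calc n + Λ * ρ < (n + Λ * ρ + 1) / (3 / 8 * ρ ^ 2) * (3 / 8 * ρ ^ 2) := by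
          rw [div_mul_cancel₀ _ h.ne']; linarith
      _ ≤ _ := by gcongr; exact le_max_right _ _
  set g : M → ℝ := (fun y => ‖y‖ ^ 2 - ε * Real.exp (-α * ‖y - F q‖ ^ 2)) ∘ F with hg
  have hgc : Continuous g := by
    rw [hg]; exact Continuous.comp (by fun_prop) hFc
  -- Points of the closed annulus are interior to `K`, so a minimum over `K` there would be a
  -- genuine local minimum, which the barrier forbids.
  have hbar : ∀ x ∈ K, ρ / 2 ≤ ‖F x - F q‖ → ‖F x - F q‖ ≤ ρ → (∀ y ∈ K, g x ≤ g y) → False := by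
    intro x hx h1 h2 hmin
    refine not_isLocalMin_barrier hF hN hε hρ hα hαρ (hH x) (hΛ x)
      (hang x (hKV hx) q (hKV hqK)) h2 h1 ?_
    filter_upwards [mem_interior_iff_mem_nhds.1 (hint x hx h2)] with y hy using hmin y hy
  obtain ⟨y, hyK, hy⟩ := hK.exists_isMinOn ⟨p, hpK⟩ hgc.continuousOn
  have hy : ∀ x ∈ K, g y ≤ g x := fun x hx => hy hx
  have hgval : ∀ x, g x = ‖F x‖ ^ 2 - ε * Real.exp (-α * ‖F x - F q‖ ^ 2) := fun x => rfl
  have hgz : g z = ‖F p‖ ^ 2 - ε * Real.exp (-α * ρ ^ 2) := by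
    rw [hgval, ← hρdef, show ‖F z‖ = ‖F p‖ from hzS]
  rcases (hy z hzK).lt_or_eq with hlt | heq
  -- A value below `g z` cannot occur off the annulus: in the inner ball the gain `ε` in `|F|²`
  -- outweighs the Gaussian, and outside the outer ball the Gaussian is smaller than at `z`, while
  -- `|F|²` is at least its minimum.
  · rw [hgz, hgval] at hlt
    refine hbar y hyK ?_ ?_ hy
    · by_contra! h
      have h1 := hεin y hyK h.le
      have h2 : ε * Real.exp (-α * ‖F y - F q‖ ^ 2) ≤ ε := by
        refine mul_le_of_le_one_right hε.le (Real.exp_le_one_iff.2 ?_)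
        have : 0 ≤ α * ‖F y - F q‖ ^ 2 := by positivity
        linarith
      have h3 : 0 < ε * Real.exp (-α * ρ ^ 2) := by positivity
      linarith
    · by_contra! h
      have h1 : ‖F p‖ ^ 2 ≤ ‖F y‖ ^ 2 := by gcongr; exact hp y
      have h2 : ε * Real.exp (-α * ‖F y - F q‖ ^ 2) ≤ ε * Real.exp (-α * ρ ^ 2) := by
        have : α * ρ ^ 2 ≤ α * ‖F y - F q‖ ^ 2 := by gcongr
        gcongr ε * Real.exp ?_
        linarith
      linarith
  -- Otherwise `z`, on the outer boundary of the annulus, is itself a minimum of `g` over `K`.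
  · exact hbar z hzK (by linarith) le_rfl fun x hx => heq ▸ hy x hx

/-- A proper hypersurface on which `|F|²` is superharmonic lies in a sphere centred at the
origin. -/
theorem exists_forall_norm_eq [T2Space M] [ConnectedSpace M]
    (hF : IsIsometricImmersion F) (hN : IsUnitNormal F N)
    (hproper : ∀ K : Set (Ambient n), IsCompact K → IsCompact (F ⁻¹' K))
    (hH : ∀ x, n ≤ meanCurvature F N x * ⟪F x, N x⟫) {Λ : ℝ}
    (hΛ : ∀ x, |meanCurvature F N x| ≤ Λ) : ∃ r, ∀ x, ‖F x‖ = r := by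
  have hFc : Continuous F := hF.contMDiff.continuous
  obtain ⟨x₀⟩ : Nonempty M := inferInstance
  -- Properness makes this sublevel set of `|F|` compact, so the global minimum is attained.
  obtain ⟨p, hpK, hp⟩ := (hproper _ (isCompact_closedBall 0 ‖F x₀‖)).exists_isMinOn
    ⟨x₀, by simp⟩ hFc.norm.continuousOn
  have hp : ∀ x, ‖F p‖ ≤ ‖F x‖ := fun x => by
    by_cases hx : ‖F x‖ ≤ ‖F x₀‖
    · exact hp (by simpa using hx)
    · have : ‖F p‖ ≤ ‖F x₀‖ := by simpa using hpK
      linarith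
  have hclopen : IsClopen {x | ‖F x‖ = ‖F p‖} := by
    refine ⟨isClosed_eq hFc.norm continuous_const, isOpen_iff_mem_nhds.2 fun x hx => ?_⟩
    have hx : ‖F x‖ = ‖F p‖ := hx
    have := eventually_norm_eq_of_forall_norm_le hF hN hH hΛ (p := x) (by rwa [hx])
    rwa [hx] at this
  have := hclopen.eq_univ ⟨p, rfl⟩
  exact ⟨‖F p‖, fun x => (this ▸ Set.mem_univ x : x ∈ {x | ‖F x‖ = ‖F p‖})⟩

end Immersion

end LambdaExpander

/-! ### Coverings glued from two simply connected pieces -/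

section Covering

open Topology Filter

variable {X S : Type*} [TopologicalSpace X] [TopologicalSpace S] {p : X → S}

/-- A covering map has a section through any given point over a simply connected open set. -/
theorem IsCoveringMap.exists_section [LocallyPathConnectedSpace S] (cov : IsCoveringMap p)
    {U : Set S} (hU : IsOpen U) (hsc : IsSimplyConnected U) {x : X} (hx : p x ∈ U) :
    ∃ s : S → X, ContinuousOn s U ∧ (∀ u ∈ U, p (s u) = u) ∧ s (p x) = x ∧ IsOpen (s '' U) := by
  have := hsc.simplyConnectedSpace
  have := hU.locallyPathConnectedSpace
  -- The section is the lift of the inclusion of `U`; its value `x` outside `U` is a dummy.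
  obtain ⟨σ, ⟨hσx, hσ⟩, -⟩ := cov.existsUnique_continuousMap_lifts
    (⟨Subtype.val, continuous_subtype_val⟩ : C(U, S)) ⟨p x, hx⟩ x rfl
  have hσ' : p ∘ σ = Subtype.val := hσ
  classical
  let s : S → X := fun u => if h : u ∈ U then σ ⟨u, h⟩ else x
  have hs : U.domRestrict s = σ := by
    ext u; simp [s]
  have hsU : ∀ u (h : u ∈ U), s u = σ ⟨u, h⟩ := fun u h => congrFun hs ⟨u, h⟩
  refine ⟨s, ?_, fun u hu => ?_, ?_, ?_⟩
  · rw [continuousOn_iff_continuous_domRestrict, hs]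
    exact σ.continuous
  · rw [hsU u hu]
    exact congrFun hσ' ⟨u, hu⟩
  · rw [hsU _ hx, hσx]
  · rw [← Set.range_domRestrict, hs]
    refine (cov.isLocalHomeomorph.isOpenEmbedding_of_comp ?_ σ.continuous).isOpen_range
    rw [hσ']
    exact hU.isOpenEmbedding_subtypeVal

/-- A covering of a union of two simply connected open sets with connected intersection, by a
connected space, is injective. -/
theorem IsCoveringMap.injective_of_isOpen_union [PreconnectedSpace X]
    [LocallyPathConnectedSpace S] (cov : IsCoveringMap p) (hp : Function.Surjective p)
    {U V : Set S} (hU : IsOpen U) (hV : IsOpen V) (hUsc : IsSimplyConnected U)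
    (hVsc : IsSimplyConnected V) (hUV : IsConnected (U ∩ V)) (hcover : U ∪ V = Set.univ) :
    Function.Injective p := by
  obtain ⟨c, hcU, hcV⟩ := hUV.nonempty
  obtain ⟨x₀, rfl⟩ := hp c
  obtain ⟨s, hsc, hsp, hs0, hso⟩ := cov.exists_section hU hUsc hcU
  obtain ⟨t, htc, htp, ht0, hto⟩ := cov.exists_section hV hVsc hcV
  have hst : (U ∩ V).EqOn s t := cov.eqOn_of_comp_eqOn hUV.isPreconnected
    (hsc.mono Set.inter_subset_left) (htc.mono Set.inter_subset_right)
    (fun u hu => (hsp u hu.1).trans (htp u hu.2).symm) ⟨hcU, hcV⟩ (hs0.trans ht0.symm)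
  -- a section through a point outside the two chosen ones avoids the section over the same set
  have hdisj : ∀ {W : Set S} (r r' : S → X), IsPreconnected W → ContinuousOn r W →
      (∀ u ∈ W, p (r u) = u) → ContinuousOn r' W → (∀ u ∈ W, p (r' u) = u) →
      ∀ u ∈ W, ∀ v ∈ W, r u = r' v → W.EqOn r r' := by
    intro W r r' hW hr hrp hr' hrp' u hu v hv huv
    have : u = v := by rw [← hrp u hu, huv, hrp' v hv]
    subst this
    exact cov.eqOn_of_comp_eqOn hW hr hr' (fun w hw => (hrp w hw).trans (hrp' w hw).symm) hu huv
  -- The union is one sheet over the whole base. It is closed because a section through a point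
  -- outside it cannot meet it: since `s = t` on `U ∩ V`, it would meet the chosen section over the
  -- same set, and so coincide with it.
  have hclopen : IsClopen (s '' U ∪ t '' V) := by
    refine ⟨⟨isOpen_iff_mem_nhds.2 fun x hx => ?_⟩, hso.union hto⟩
    have hx' : p x ∈ U ∪ V := hcover ▸ Set.mem_univ _
    rcases hx' with hxU | hxV
    · obtain ⟨r, hrc, hrp, hr0, hro⟩ := cov.exists_section hU hUsc hxU
      refine mem_of_superset (hro.mem_nhds ⟨p x, hxU, hr0⟩) ?_
      rintro _ ⟨u, hu, rfl⟩ hmem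
      have hsu : ∃ v ∈ U, s v = r u := by
        rcases hmem with ⟨v, hv, hvu⟩ | ⟨v, hv, hvu⟩
        · exact ⟨v, hv, hvu⟩
        · have : v = u := by rw [← htp v hv, hvu, hrp u hu]
          subst this
          exact ⟨v, hu, (hst ⟨hu, hv⟩).trans hvu⟩
      obtain ⟨v, hv, hvu⟩ := hsu
      have := hdisj s r hUsc.isPathConnected.isConnected.isPreconnected hsc hsp hrc hrp v hv u hu
        hvu hxU
      exact hx (Or.inl ⟨p x, hxU, this.trans hr0⟩)
    · obtain ⟨r, hrc, hrp, hr0, hro⟩ := cov.exists_section hV hVsc hxV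
      refine mem_of_superset (hro.mem_nhds ⟨p x, hxV, hr0⟩) ?_
      rintro _ ⟨u, hu, rfl⟩ hmem
      have htu : ∃ v ∈ V, t v = r u := by
        rcases hmem with ⟨v, hv, hvu⟩ | ⟨v, hv, hvu⟩
        · have : v = u := by rw [← hsp v hv, hvu, hrp u hu]
          subst this
          exact ⟨v, hu, (hst ⟨hv, hu⟩).symm.trans hvu⟩
        · exact ⟨v, hv, hvu⟩
      obtain ⟨v, hv, hvu⟩ := htu
      have := hdisj t r hVsc.isPathConnected.isConnected.isPreconnected htc htp hrc hrp v hv u hu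
        hvu hxV
      exact hx (Or.inr ⟨p x, hxV, this.trans hr0⟩)
  have huniv := hclopen.eq_univ ⟨x₀, Or.inl ⟨p x₀, hcU, hs0⟩⟩
  have hmem : ∀ x, (p x ∈ U ∧ s (p x) = x) ∨ (p x ∈ V ∧ t (p x) = x) := fun x => by
    rcases huniv ▸ Set.mem_univ x with ⟨u, hu, rfl⟩ | ⟨u, hu, rfl⟩
    · left; rw [hsp u hu]; exact ⟨hu, rfl⟩
    · right; rw [htp u hu]; exact ⟨hu, rfl⟩
  intro x y hxy
  rcases hmem x with ⟨hx, hx'⟩ | ⟨hx, hx'⟩ <;> rcases hmem y with ⟨hy, hy'⟩ | ⟨hy, hy'⟩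
  · rw [← hx', ← hy', hxy]
  · rw [← hx', ← hy', hxy]; rw [hxy] at hx; exact hst ⟨hx, hy⟩
  · rw [← hx', ← hy', hxy]; rw [hxy] at hx; exact (hst ⟨hy, hx⟩).symm
  · rw [← hx', ← hy', hxy]

end Covering

/-! ### Simple connectedness and coverings of the sphere -/

section Sphere

open Metric Module

variable {E : Type*} [NormedAddCommGroup E] [InnerProductSpace ℝ E]

theorem isSimplyConnected_sphere_compl_singleton (v : sphere (0 : E) 1) :
    IsSimplyConnected ({v}ᶜ : Set (sphere (0 : E) 1)) := by
  have hv : ‖(v : E)‖ = 1 := norm_eq_of_mem_sphere v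
  rw [← range_stereographic_symm hv, ← Set.image_univ,
    (isOpenEmbedding_stereographic_symm hv).isEmbedding.isSimplyConnected_image]
  exact (Homeomorph.Set.univ _).toHomotopyEquiv.simplyConnectedSpace

/-- A covering of a unit sphere of dimension at least two by a connected space is injective. -/
theorem IsCoveringMap.injective_of_sphere {n : ℕ} [Fact (finrank ℝ E = n + 1)] (hn : 2 ≤ n)
    {X : Type*} [TopologicalSpace X] [PreconnectedSpace X] {p : X → sphere (0 : E) 1}
    (cov : IsCoveringMap p) (hp : Function.Surjective p) : Function.Injective p := by
  have hfin : finrank ℝ E = n + 1 := Fact.out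
  have : FiniteDimensional ℝ E := .of_fact_finrank_eq_succ n
  have : LocallyPathConnectedSpace (sphere (0 : E) 1) :=
    ChartedSpace.locallyPathConnectedSpace (EuclideanSpace ℝ (Fin n)) _
  have : Nontrivial E := nontrivial_of_finrank_pos (R := ℝ) (by omega)
  obtain ⟨v⟩ : Nonempty (sphere (0 : E) 1) := (NormedSpace.sphere_nonempty.2 zero_le_one).to_subtype
  have hv : ‖(v : E)‖ = 1 := norm_eq_of_mem_sphere v
  refine cov.injective_of_isOpen_union hp (isOpen_compl_singleton (x := v))
    (isOpen_compl_singleton (x := -v)) (isSimplyConnected_sphere_compl_singleton v)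
    (isSimplyConnected_sphere_compl_singleton (-v)) ?_ ?_
  · have hrank : 1 < Module.rank ℝ (ℝ ∙ (v : E))ᗮ := by
      have h1 : finrank ℝ (ℝ ∙ (v : E))ᗮ = n :=
        Submodule.finrank_orthogonal_span_singleton (ne_zero_of_mem_unit_sphere v)
      rw [← finrank_eq_rank, h1]
      exact_mod_cast hn
    -- Stereographic projection from `v` sends `-v` to the origin, so the twice punctured sphere is
    -- a punctured space of dimension `n`, connected because `2 ≤ n`.
    have himg : (stereographic hv).symm '' {0}ᶜ = ({v}ᶜ ∩ {-v}ᶜ : Set (sphere (0 : E) 1)) := by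
      have h0 : (stereographic hv).symm 0 = -v := by
        have h1 : -v ∈ (stereographic hv).source := by
          rw [stereographic_source]
          exact (ne_neg_of_mem_unit_sphere ℝ v).symm
        exact (congrArg (stereographic hv).symm (stereographic_apply_neg v)).symm.trans
          ((stereographic hv).left_inv h1)
      rw [Set.image_compl_eq_range_sdiff_image
        (isOpenEmbedding_stereographic_symm hv).injective, Set.image_singleton, h0,
        range_stereographic_symm hv, Set.sdiff_eq]
    rw [← himg]
    exact (isConnected_compl_singleton_of_one_lt_rank hrank 0).image _
      (isOpenEmbedding_stereographic_symm hv).continuous.continuousOn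
  · refine Set.eq_univ_of_forall fun x => ?_
    by_contra! h
    simp only [Set.mem_union, Set.mem_compl_iff, Set.mem_singleton_iff, not_or, not_not] at h
    exact ne_neg_of_mem_unit_sphere ℝ v (h.1.symm.trans h.2)

/-- Dilation from the sphere of radius `r` onto the unit sphere. -/
noncomputable def sphereHomeomorphUnitSphere {r : ℝ} (hr : 0 < r) :
    sphere (0 : E) r ≃ₜ sphere (0 : E) 1 :=
  (Homeomorph.smulOfNeZero r⁻¹ (inv_ne_zero hr.ne')).subtype fun x => by
    simp [norm_smul, abs_of_pos hr, inv_mul_eq_one₀ hr.ne', eq_comm]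

end Sphere

/-! ### Immersions into a sphere of the same dimension -/

namespace LambdaExpander

section Sphere

open Topology Filter Metric

variable {n : ℕ} {M : Type*} [TopologicalSpace M] [ChartedSpace (EuclideanSpace ℝ (Fin n)) M]
  [RiemannianBundle (fun p : M => TangentSpace (𝓡 n) p)] {F N : M → Ambient n}
  [IsManifold (𝓡 n) ∞ M]

/-- Differentiate `|F|² = r²`. Radial directions are therefore transverse to the image, which makes
the cone over `F` nondegenerate. -/
theorem inner_differential_self_of_norm_eq (hF : IsIsometricImmersion F) {r : ℝ}
    (hr : ∀ x, ‖F x‖ = r) (p : M) (v : EuclideanSpace ℝ (Fin n)) :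
    ⟪F p, fderiv ℝ (inChart F p) (extChartAt (𝓡 n) p p) v⟫ = 0 := by
  have hd : DifferentiableAt ℝ (inChart F p) (extChartAt (𝓡 n) p p) :=
    (contDiffAt_inChart hF.contMDiff p (mem_extChartAt_target p)).differentiableAt (by simp)
  have h1 := hd.hasFDerivAt.norm_sq
  have h2 : (fun x => ‖inChart F p x‖ ^ 2) = fun _ => r ^ 2 := by
    ext x; simp [inChart, hr]
  rw [h2] at h1
  have := congrArg (fun L => L v) (h1.unique (hasFDerivAt_const _ _))
  rw [← inChart_apply_extChartAt F p]
  simpa using this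

/-- An immersion of an `n`-manifold into the `n`-sphere is open as a map to the sphere. -/
theorem isOpenMap_codRestrict_sphere (hF : IsIsometricImmersion F) {r : ℝ} (hr0 : 0 < r)
    (hr : ∀ x, ‖F x‖ = r) (hS : ∀ x, F x ∈ sphere (0 : Ambient n) r) :
    IsOpenMap (Set.codRestrict F (sphere (0 : Ambient n) r) hS) := by
  rw [isOpenMap_iff_nhds_le]
  intro p W hW
  set φ := extChartAt (𝓡 n) p with hφ
  have hxt : φ p ∈ φ.target := mem_extChartAt_target p
  have hs : HasStrictFDerivAt (inChart F p) (fderiv ℝ (inChart F p) (φ p)) (φ p) :=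
    (contDiffAt_inChart hF.contMDiff p hxt).hasStrictFDerivAt (by simp)
  set L := fderiv ℝ (inChart F p) (φ p) with hL
  have hF0 : inChart F p (φ p) = F p := inChart_apply_extChartAt F p
  -- the cone over the immersion is a local homeomorphism
  have hcone : HasStrictFDerivAt (fun z : EuclideanSpace ℝ (Fin n) × ℝ => z.2 • inChart F p z.1)
      (L ∘L .fst ℝ _ ℝ + (ContinuousLinearMap.snd ℝ _ ℝ).smulRight (F p)) (φ p, 1) := by
    have h1 : HasStrictFDerivAt (fun z : EuclideanSpace ℝ (Fin n) × ℝ => inChart F p z.1)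
        (L ∘L .fst ℝ _ ℝ) (φ p, 1) :=
      HasStrictFDerivAt.comp (φ p, (1 : ℝ)) (g := inChart F p) hs hasStrictFDerivAt_fst
    refine (HasStrictFDerivAt.smul hasStrictFDerivAt_snd h1).congr_fderiv ?_
    ext <;> simp [hF0]
  have hinj : Function.Injective
      (L ∘L .fst ℝ _ ℝ + (ContinuousLinearMap.snd ℝ _ ℝ).smulRight (F p)).toLinearMap := by
    rw [injective_iff_map_eq_zero]
    rintro ⟨v, τ⟩ h
    have h : L v + τ • F p = 0 := by simpa using h
    have h1 : ⟪F p, L v + τ • F p⟫ = τ * r ^ 2 := by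
      rw [inner_add_right, inner_differential_self_of_norm_eq hF hr, inner_smul_right,
        real_inner_self_eq_norm_sq, hr, zero_add]
    rw [h, inner_zero_right] at h1
    have hτ : τ = 0 := by
      have : r ^ 2 ≠ 0 := by positivity
      simpa [this] using h1.symm
    subst hτ
    have hv : differential F p v = 0 := by
      rw [← fderiv_inChart hF.contMDiff p v]
      change L v = 0
      simpa using h
    have : v = 0 := hF.differential_injective p (hv.trans (map_zero (differential F p)).symm)
    simp [this]
  have hsurj := (LinearMap.injective_iff_surjective_of_finrank_eq_finrank (by simp)).1 hinj
  have hmap := hcone.map_nhds_eq_of_surj (LinearMap.range_eq_top.2 hsurj)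
  simp only [one_smul, hF0] at hmap
  have hW1 : ∀ᶠ x in 𝓝 (φ p),
      Set.codRestrict F (sphere (0 : Ambient n) r) hS (φ.symm x) ∈ W := by
    have ht : Tendsto φ.symm (𝓝 (φ p)) (𝓝 p) := by
      simpa [hφ] using (continuousAt_extChartAt_symm (I := 𝓡 n) p).tendsto
    exact ht.eventually hW
  have hW2 : ∀ᶠ z : EuclideanSpace ℝ (Fin n) × ℝ in 𝓝 (φ p, 1),
      Set.codRestrict F (sphere (0 : Ambient n) r) hS (φ.symm z.1) ∈ W ∧ 0 < z.2 := by
    rw [nhds_prod_eq]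
    exact hW1.prod_mk (lt_mem_nhds zero_lt_one)
  have hW3 := image_mem_map (m := fun z : EuclideanSpace ℝ (Fin n) × ℝ =>
    z.2 • inChart F p z.1) hW2
  rw [hmap] at hW3
  have hW4 := (continuous_subtype_val (p := (· ∈ sphere (0 : Ambient n) r))).continuousAt
    (x := Set.codRestrict F (sphere (0 : Ambient n) r) hS p) hW3
  refine mem_of_superset hW4 ?_
  rintro ⟨y, hy⟩ ⟨⟨x, t⟩, ⟨hx, ht⟩, hxy⟩
  have hxy : t • F (φ.symm x) = y := hxy
  -- A point of the cone with `t > 0` that lies on the sphere has `t = 1`, so it comes from `F`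
  -- itself.
  have hnorm : t * r = r := by
    have := congrArg norm hxy
    rwa [norm_smul, hr, mem_sphere_zero_iff_norm.1 hy, Real.norm_of_nonneg ht.le] at this
  have ht1 : t = 1 := by
    have := hr0.ne'
    field_simp at hnorm
    exact hnorm
  rw [ht1, one_smul] at hxy
  have : (⟨y, hy⟩ : sphere (0 : Ambient n) r) =
      Set.codRestrict F (sphere (0 : Ambient n) r) hS (φ.symm x) := Subtype.ext hxy.symm
  rw [this]
  exact hx

theorem isLocalHomeomorph_codRestrict_sphere (hF : IsIsometricImmersion F)
    (hN : IsUnitNormal F N) {r : ℝ} (hr0 : 0 < r)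
    (hr : ∀ x, ‖F x‖ = r) (hS : ∀ x, F x ∈ sphere (0 : Ambient n) r) :
    IsLocalHomeomorph (Set.codRestrict F (sphere (0 : Ambient n) r) hS) := by
  rw [isLocalHomeomorph_iff_isOpenEmbedding_restrict]
  intro p
  obtain ⟨V, hV, hinj, -⟩ := exists_nhds_injOn_and_abs_inner_le hF hN p
  obtain ⟨U, hUV, hU, hpU⟩ := mem_nhds_iff.1 hV
  refine ⟨U, hU.mem_nhds hpU, .of_continuous_injective_isOpenMap ?_ ?_ ?_⟩
  · exact (hF.contMDiff.continuous.codRestrict hS).comp continuous_subtype_val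
  · intro x y hxy
    exact Subtype.ext (hinj (hUV x.2) (hUV y.2) (congrArg Subtype.val hxy))
  · exact (isOpenMap_codRestrict_sphere hF hr0 hr hS).comp hU.isOpenEmbedding_subtypeVal.isOpenMap

end Sphere

end LambdaExpander

/-! ### The classification -/

theorem mainTheorem11 {n : ℕ} (hn : 1 ≤ n) {M : Type*} [MetricSpace M]
    [ChartedSpace (EuclideanSpace ℝ (Fin n)) M] [IsManifold (𝓡 n) ∞ M]
    [RiemannianBundle (fun p : M => TangentSpace (𝓡 n) p)]
    [IsContMDiffRiemannianBundle (𝓡 n) ∞ (EuclideanSpace ℝ (Fin n))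
      (fun p : M => TangentSpace (𝓡 n) p)]
    [IsRiemannianManifold (𝓡 n) M] [ConnectedSpace M] [CompleteSpace M]
    (lam : ℝ) (F N : M → LambdaExpander.Ambient n)
    (hF : LambdaExpander.IsSelfExpander lam F N)
    (hproper : ∀ K : Set (LambdaExpander.Ambient n), IsCompact K → IsCompact (F ⁻¹' K))
    (hH : ∀ p : M, 2 * (n : ℝ) + (lam - 2 * LambdaExpander.meanCurvature F N p) ^ 2 ≤ lam ^ 2) :
    ∃ r : ℝ, 0 < r ∧ Set.range F = Metric.sphere (0 : LambdaExpander.Ambient n) r ∧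
      (∃ hS : ∀ p : M, F p ∈ Metric.sphere (0 : LambdaExpander.Ambient n) r,
        IsCoveringMap (Set.codRestrict F (Metric.sphere (0 : LambdaExpander.Ambient n) r) hS)) ∧
      (2 ≤ n → Function.Injective F) := by
  have hI := hF.isometricImmersion
  have hU := hF.unitNormal
  have hs : ∀ p, ⟪F p, N p⟫ = 2 * (lam - LambdaExpander.meanCurvature F N p) := fun p => by
    have := hF.meanCurvature_eq p
    linarith
  -- Expanding the square turns the pinching condition into `n ≤ 2 H (lam - H)`.
  have hsuper : ∀ p, (n : ℝ) ≤ LambdaExpander.meanCurvature F N p * ⟪F p, N p⟫ := fun p => by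
    rw [hs]
    have := hH p
    linarith
  -- Pinching also bounds `H`, as the barrier needs: `2H` is the difference of `lam` and `lam - 2H`,
  -- both of absolute value at most `|lam|`.
  have hbound : ∀ p, |LambdaExpander.meanCurvature F N p| ≤ |lam| := fun p => by
    have h1 : |lam - 2 * LambdaExpander.meanCurvature F N p| ≤ |lam| :=
      sq_le_sq.1 (by have := hH p; have := n.cast_nonneg (α := ℝ); linarith)
    have h2 := abs_sub lam (lam - 2 * LambdaExpander.meanCurvature F N p)
    rw [sub_sub_cancel, abs_mul, abs_two] at h2
    linarith
  obtain ⟨r, hr⟩ := LambdaExpander.exists_forall_norm_eq hI hU hproper hsuper hbound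
  obtain ⟨p₀⟩ : Nonempty M := inferInstance
  have hr0 : 0 < r := by
    rw [← hr p₀, norm_pos_iff]
    intro h0
    have := hsuper p₀
    rw [h0, inner_zero_left, mul_zero] at this
    have hn' : (1 : ℝ) ≤ n := by exact_mod_cast hn
    linarith
  have hS : ∀ p, F p ∈ Metric.sphere (0 : LambdaExpander.Ambient n) r := fun p => by simp [hr]
  have hcompact : CompactSpace M := by
    refine isCompact_univ_iff.1 ?_
    convert hproper _ (isCompact_sphere (0 : LambdaExpander.Ambient n) r)
    exact (Set.eq_univ_of_forall hS).symm
  -- Compactness of `M` is what upgrades the local homeomorphism to a covering.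
  have hcov : IsCoveringMap (Set.codRestrict F (Metric.sphere (0 : LambdaExpander.Ambient n) r) hS) :=
    isLocalHomeomorph_iff_isCoveringMap.1
      (LambdaExpander.isLocalHomeomorph_codRestrict_sphere hI hU hr0 hr hS)
  have hconn : ConnectedSpace (Metric.sphere (0 : LambdaExpander.Ambient n) r) := by
    refine isConnected_iff_connectedSpace.1 (isConnected_sphere ?_ _ hr0.le)
    rw [← Module.finrank_eq_rank, finrank_euclideanSpace_fin]
    exact_mod_cast Nat.lt_succ_of_le hn
  have hsurj : Function.Surjective
      (Set.codRestrict F (Metric.sphere (0 : LambdaExpander.Ambient n) r) hS) := by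
    rw [← Set.range_eq_univ]
    exact IsClopen.eq_univ ⟨(isCompact_range hcov.continuous).isClosed,
      hcov.isLocalHomeomorph.isOpenMap.isOpen_range⟩ ⟨_, p₀, rfl⟩
  refine ⟨r, hr0, ?_, ⟨hS, hcov⟩, fun h2 => ?_⟩
  · refine Set.Subset.antisymm (Set.range_subset_iff.2 hS) fun y hy => ?_
    obtain ⟨x, hx⟩ := hsurj ⟨y, hy⟩
    exact ⟨x, congrArg Subtype.val hx⟩
  · have hfact : Fact (Module.finrank ℝ (LambdaExpander.Ambient n) = n + 1) := ⟨by simp⟩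
    have hinj := (hcov.homeomorph_comp (sphereHomeomorphUnitSphere hr0)).injective_of_sphere h2
      ((sphereHomeomorphUnitSphere hr0).surjective.comp hsurj)
    exact fun x y hxy => hinj.of_comp (Subtype.ext hxy)
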